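/- Let $p$ be a prime with $p\equiv 3 \pmod 4$. For $j\ge 1$ put $N_j=p^{2j-1}$, let $K_j$ be the integer with $N_j=2K_j+1$, and put $B_j=\{0,K_j\}$ and $$\nu_j=\tfrac12\sum_{b\in B_j}\delta_{b/(N_1N_2\cdots N_j)}.$$ Then the finite convolutions $\nu_1*\cdots*\nu_n$ converge weakly, as $n\to\infty$, to a Borel probability measure $\mu=\nu_1*\nu_2*\cdots$ on $\mathbb R$ with the following properties. 1. $\mu$ is a singular fractal measure: it has compact support, it has no atoms, and it is singular with respect to Lebesgue measure. 2. $\mu$ is not spectral: for no set $\Lambda\subset\mathbb R$ do the exponentials $\{e^{2\pi i\lambda x}\}_{\lambda\in\Lambda}$ form an orthonormal basis of $L^2(\mu)$. 3. If $\Lambda\subset\mathbb R$ is such that the exponentials $e^{2\pi i\lambda x}$, $\lambda\in\Lambda$, are mutually orthogonal in $L^2(\mu)$, then $\#\Lambda\le 2$. 4. $L^2(\mu)$ admits a Fourier frame: there are a set $\Lambda\subset\mathbb R$ and constants $0<A\le B<\infty$ with $$A\|f\|_2^2\le\sum_{\lambda\in\Lambda}\left|\int f(x)e^{-2\pi i\lambda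 x}\,d\mu(x)\right|^2\le B\|f\|_2^2\qquad\text{for all } f\in L^2(\mu).$$ In particular (take $p=3$), there exists a non-spectral fractal measure which has only finitely many mutually orthogonal exponentials but still admits a Fourier frame. -/

import Mathlib

open MeasureTheory Filter Topology
open scoped ENNReal BoundedContinuousFunction

/-! ### Exponentials, Fourier frames and spectra of a finite Borel measure on the line -/

/-- The exponential function `x ↦ exp (2 π i t x)` of frequency `t`. -/
noncomputable def expFun (t : ℝ) : ℝ → ℂ :=
  fun x => Complex.exp (2 * Real.pi * Complex.I * t * x)

theorem expFun_memLp (μ : Measure ℝ) [IsFiniteMeasure μ] (t : ℝ) : MemLp (expFun t) 2 μ := by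
  refine MemLp.of_bound (C := 1) ?_ (ae_of_all _ fun x => ?_)
  · exact Continuous.aestronglyMeasurable (by unfold expFun; fun_prop)
  · have h : (2 * Real.pi * Complex.I * t * x : ℂ) = ((2 * Real.pi * t * x : ℝ) : ℂ) * Complex.I := by
      push_cast; ring
    rw [expFun, h, Complex.norm_exp_ofReal_mul_I]

/-- The exponential of frequency `t` as an element of `L²(μ)`. -/
noncomputable def expLp (μ : Measure ℝ) [IsFiniteMeasure μ] (t : ℝ) : Lp ℂ 2 μ :=
  (expFun_memLp μ t).toLp (expFun t)

/-- The exponentials with frequencies in `Λ` are mutually orthogonal in `L²(μ)`. -/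
def IsMutuallyOrthogonal (μ : Measure ℝ) [IsFiniteMeasure μ] (Λ : Set ℝ) : Prop :=
  Λ.Pairwise fun s t => inner ℂ (expLp μ s) (expLp μ t) = 0

/-- `Λ` is a spectrum of `μ`: the exponentials with frequencies in `Λ` form an orthonormal
(Hilbert) basis of `L²(μ)`. -/
def IsSpectrum (μ : Measure ℝ) [IsFiniteMeasure μ] (Λ : Set ℝ) : Prop :=
  ∃ b : HilbertBasis Λ ℂ (Lp ℂ 2 μ), ∀ t : Λ, b t = expLp μ t

/-- `μ` is a spectral measure. -/
def IsSpectralMeasure (μ : Measure ℝ) [IsFiniteMeasure μ] : Prop :=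
  ∃ Λ : Set ℝ, IsSpectrum μ Λ

/-- `Λ` is a frame spectrum of `μ`: the exponentials with frequencies in `Λ` form a Fourier frame
for `L²(μ)`, with some frame bounds `0 < A ≤ B < ∞`. -/
def IsFrameSpectrum (μ : Measure ℝ) (Λ : Set ℝ) : Prop :=
  ∃ A B : ℝ, 0 < A ∧ A ≤ B ∧ ∀ f : Lp ℂ 2 μ,
    Summable (fun t : Λ =>
      ‖∫ x, f x * Complex.exp (-2 * Real.pi * Complex.I * (t : ℝ) * x) ∂μ‖ ^ 2) ∧
    A * ‖f‖ ^ 2 ≤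
      ∑' t : Λ, ‖∫ x, f x * Complex.exp (-2 * Real.pi * Complex.I * (t : ℝ) * x) ∂μ‖ ^ 2 ∧
    ∑' t : Λ, ‖∫ x, f x * Complex.exp (-2 * Real.pi * Complex.I * (t : ℝ) * x) ∂μ‖ ^ 2 ≤
      B * ‖f‖ ^ 2

/-- `μ` is a frame spectral measure, i.e. `L²(μ)` admits a Fourier frame. -/
def IsFrameSpectralMeasure (μ : Measure ℝ) : Prop :=
  ∃ Λ : Set ℝ, IsFrameSpectrum μ Λ

/-- A fractal measure: compactly supported, without atoms, and singular with respect to Lebesgue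
measure. -/
structure IsFractalMeasure (μ : Measure ℝ) : Prop where
  isCompact_support : IsCompact μ.support
  noAtoms : ∀ x : ℝ, μ {x} = 0
  singular : μ ⟂ₘ (volume : Measure ℝ)

/-! ### Moran measures as infinite convolutions -/

/-- The finite convolution `ν 0 ∗ ν 1 ∗ ⋯ ∗ ν (n - 1)`; the empty one is the Dirac mass at `0`. -/
noncomputable def partialConv (ν : ℕ → Measure ℝ) : ℕ → Measure ℝ
  | 0 => Measure.dirac 0
  | n + 1 => (partialConv ν n).conv (ν n)

/-- `μ` is the infinite convolution `ν 0 ∗ ν 1 ∗ ⋯`: the finite convolutions converge weakly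
to `μ`. -/
def IsInfiniteConv (ν : ℕ → Measure ℝ) (μ : Measure ℝ) : Prop :=
  ∀ f : ℝ →ᵇ ℝ, Tendsto (fun n => ∫ x, f x ∂(partialConv ν n)) atTop (𝓝 (∫ x, f x ∂μ))

/-- The uniform probability measure on the points `b / (N 0 * N 1 * ⋯ * N j)`, `b ∈ B j`
(sequences are indexed from `0`). -/
noncomputable def moranFactor (N : ℕ → ℕ) (B : ℕ → Finset ℕ) (j : ℕ) : Measure ℝ :=
  ((B j).card : ℝ≥0∞)⁻¹ •
    ∑ b ∈ B j, Measure.dirac ((b : ℝ) / ((∏ i ∈ Finset.range (j + 1), N i : ℕ) : ℝ))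

/-- `μ` is the Moran measure associated to the sequences `N` and `B`. -/
def IsMoranMeasure (N : ℕ → ℕ) (B : ℕ → Finset ℕ) (μ : Measure ℝ) : Prop :=
  IsInfiniteConv (moranFactor N B) μ

/-- The moduli `p, p ^ 3, p ^ 5, …`; with indices from `0` the `j`-th one is `p ^ (2 * j + 1)`. -/
def oddPowers (p : ℕ) (j : ℕ) : ℕ := p ^ (2 * j + 1)

/-- The digit sets `{0, K}` where `p ^ (2 * j + 1) = 2 * K + 1` (for odd `p`). -/
def twoDigits (p : ℕ) (j : ℕ) : Finset ℕ := {0, (oddPowers p j - 1) / 2}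

/-- The digit `K` is as described: `p ^ (2 * j + 1) = 2 * K + 1`. -/
theorem oddPowers_eq (p : ℕ) (hp : p % 4 = 3) (j : ℕ) :
    oddPowers p j = 2 * ((oddPowers p j - 1) / 2) + 1 := by
  have h : Odd (oddPowers p j) := Odd.pow (Nat.odd_iff.mpr (by omega))
  obtain ⟨k, hk⟩ := h
  omega

/-! ### Exponentials -/

/-! With indices from 0, the nonzero atom of the `j`-th factor is `a_j = (p^(-j²) - p^(-(j+1)²)) /
2`, and μ is the law of `∑ ε_j a_j` for independent fair bits `ε_j`. The `a_j` telescope, so the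
tail from `n` on has length at most `p^(-n²)/2`. This is less than `a_(n-1)`, so the bits are
determined by the sum and there are no atoms. The support is covered by `2^n` intervals of that
length, so it is Lebesgue-null.

Orthogonality: the transform of μ is an infinite product that vanishes only where a factor does,
which forces `2s = odd · p^((j+1)²) / K_j`. As `N_j ≡ 3 mod 4`, `K_j` is odd, so every zero `s` has
2-adic valuation `-1`. Among three frequencies the differences satisfy `c - a = (b - a) + (c - b)`,
and two numbers of valuation `-1` never sum to a third. A spectrum would thus have at most two
elements, whereas `L²(μ)` is infinite-dimensional.

Frame: take the frequencies `∑ ε_j p^(j²)`. Adding `p^(n²)` to a frequency leaves the transforms at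
level `n` unchanged and multiplies the phase of the new atom by `z = exp(-2πi K_n/N_n)`, which is
within `π/N_n` of `-1`. At `z = -1` the parallelogram law would give an exact Parseval identity;
here each level costs a factor `1 ± c_n` with `∑ c_n < ∞` (`finiteFourier_frame_bounds`). The tail
transform is at least `1/2` in modulus at the frequencies of level `n`, so the lower bound survives
the limit for uniformly continuous functions (`finiteFourier_frame_lower_tail`); density does the
rest. -/

theorem expFun_zero_right (t : ℝ) : expFun t 0 = 1 := by simp [expFun]

theorem expFun_add_right (t x y : ℝ) : expFun t (x + y) = expFun t x * expFun t y := by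
  simp only [expFun, ← Complex.exp_add]
  congr 1
  push_cast
  ring

theorem expFun_add_left (s t x : ℝ) : expFun (s + t) x = expFun s x * expFun t x := by
  simp only [expFun, ← Complex.exp_add]
  congr 1
  push_cast
  ring

theorem expFun_eq_ofReal_mul_I (t x : ℝ) :
    expFun t x = Complex.exp ((2 * Real.pi * t * x : ℝ) * Complex.I) := by
  rw [expFun]
  congr 1
  push_cast
  ring

theorem norm_expFun (t x : ℝ) : ‖expFun t x‖ = 1 := by
  rw [expFun_eq_ofReal_mul_I, Complex.norm_exp_ofReal_mul_I]

theorem expFun_re (t x : ℝ) : (expFun t x).re = Real.cos (2 * Real.pi * t * x) := by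
  rw [expFun_eq_ofReal_mul_I, Complex.exp_ofReal_mul_I_re]

theorem continuous_expFun (t : ℝ) : Continuous (expFun t) := by
  unfold expFun
  fun_prop

theorem expFun_neg_eq_one_of_int {t x : ℝ} (h : ∃ m : ℤ, x * t = m) : expFun (-t) x = 1 := by
  obtain ⟨m, hm⟩ := h
  have : (2 * Real.pi * Complex.I * (-t : ℝ) * x : ℂ) = (-m : ℤ) * (2 * Real.pi * Complex.I) := by
    have h' : (x : ℂ) * t = m := by exact_mod_cast hm
    push_cast
    linear_combination (-2 * Real.pi * Complex.I) * h'
  rw [expFun, this, Complex.exp_int_mul_two_pi_mul_I]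

/-! ### Averages over the points `∑ j < n, ε j * a j`, `ε j ∈ {0, 1}` -/

section Average

variable {V : Type*} [AddCommGroup V] [Module ℝ V]

/-- The average of `f` over the `2 ^ n` points `∑ j < n, ε j * a j` with `ε j ∈ {0, 1}`. -/
noncomputable def binaryAvg (a : ℕ → ℝ) : ℕ → (ℝ → V) → V
  | 0, f => f 0
  | n + 1, f => (2⁻¹ : ℝ) • (binaryAvg a n f + binaryAvg a n fun x => f (x + a n))

variable (a : ℕ → ℝ)

theorem binaryAvg_add (n : ℕ) (f g : ℝ → V) :
    binaryAvg a n (fun x => f x + g x) = binaryAvg a n f + binaryAvg a n g := by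
  induction n generalizing f g with
  | zero => rfl
  | succ n ih => simp only [binaryAvg, ih, smul_add]; abel

theorem binaryAvg_const (n : ℕ) (v : V) : binaryAvg a n (fun _ => v) = v := by
  induction n with
  | zero => rfl
  | succ n ih => simp only [binaryAvg, ih, ← two_smul ℝ v, smul_smul]; norm_num

theorem binaryAvg_mul_const (n : ℕ) (c : ℂ) (f : ℝ → ℂ) :
    binaryAvg a n (fun x => f x * c) = binaryAvg a n f * c := by
  induction n generalizing f with
  | zero => rfl
  | succ n ih => simp only [binaryAvg, ih, ← add_mul, smul_mul_assoc]

theorem binaryAvg_sum {ι : Type*} (n : ℕ) (s : Finset ι) (f : ι → ℝ → V) :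
    binaryAvg a n (fun x => ∑ i ∈ s, f i x) = ∑ i ∈ s, binaryAvg a n (f i) := by
  classical
  induction s using Finset.induction_on with
  | empty => simp [binaryAvg_const]
  | insert i s hi ih => simp only [Finset.sum_insert hi, binaryAvg_add, ih]

theorem binaryAvg_re (n : ℕ) (f : ℝ → ℂ) :
    (binaryAvg a n f).re = binaryAvg a n fun x => (f x).re := by
  induction n generalizing f with
  | zero => rfl
  | succ n ih => simp [binaryAvg, ih, mul_add]

/-- Separates the first `n` digits (inner average) from the tail (outer average); tail estimates
enter through this form. -/
theorem binaryAvg_split (n k : ℕ) (f : ℝ → V) :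
    binaryAvg a (n + k) f =
      binaryAvg (fun j => a (n + j)) k fun t => binaryAvg a n fun x => f (x + t) := by
  induction k generalizing f with
  | zero => simp [binaryAvg]
  | succ k ih =>
    rw [← add_assoc, binaryAvg, ih, ih, binaryAvg]
    simp only [add_assoc]

variable {a}

theorem binaryAvg_mono (ha : ∀ j, 0 ≤ a j) (n : ℕ) {f g : ℝ → ℝ}
    (h : ∀ t, 0 ≤ t → t ≤ ∑ j ∈ Finset.range n, a j → f t ≤ g t) :
    binaryAvg a n f ≤ binaryAvg a n g := by
  induction n generalizing f g with
  | zero => exact h 0 le_rfl (by simp)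
  | succ n ih =>
    rw [Finset.sum_range_succ] at h
    have h1 := ih (f := f) (g := g) fun t h0 h1 => h t h0 (by linarith [ha n])
    have h2 := ih (f := fun x => f (x + a n)) (g := fun x => g (x + a n)) fun t h0 h1 =>
      h (t + a n) (by linarith [ha n]) (by linarith)
    simp only [binaryAvg, smul_eq_mul]
    linarith

theorem norm_sq_half_add_le {W : Type*} [NormedAddCommGroup W] [NormedSpace ℝ W] (x y : W) :
    ‖(2⁻¹ : ℝ) • (x + y)‖ ^ 2 ≤ 2⁻¹ * (‖x‖ ^ 2 + ‖y‖ ^ 2) := by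
  have h := norm_add_le x y
  rw [norm_smul, Real.norm_of_nonneg (by norm_num)]
  nlinarith [sq_nonneg (‖x‖ - ‖y‖), norm_nonneg (x + y), norm_nonneg x, norm_nonneg y]

theorem norm_sq_binaryAvg_le {W : Type*} [NormedAddCommGroup W] [NormedSpace ℝ W]
    (a : ℕ → ℝ) (n : ℕ) (f : ℝ → W) :
    ‖binaryAvg a n f‖ ^ 2 ≤ binaryAvg a n fun x => ‖f x‖ ^ 2 := by
  induction n generalizing f with
  | zero => exact le_rfl
  | succ n ih =>
    refine (norm_sq_half_add_le _ _).trans ?_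
    simp only [binaryAvg, smul_eq_mul]
    linarith [ih f, ih fun x => f (x + a n)]

/-- The transform of a finite convolution is the product of the factors `(1 + expFun t (a j)) / 2`.
-/
theorem binaryAvg_expFun_ne_zero (n : ℕ) (t : ℝ) (h : ∀ j < n, 1 + expFun t (a j) ≠ 0) :
    binaryAvg a n (expFun t) ≠ 0 := by
  induction n with
  | zero => simp [binaryAvg, expFun_zero_right]
  | succ n ih =>
    have : binaryAvg a (n + 1) (expFun t) =
        (2⁻¹ : ℝ) • (binaryAvg a n (expFun t) * (1 + expFun t (a n))) := by
      simp only [binaryAvg, expFun_add_right, binaryAvg_mul_const]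
      ring_nf
    rw [this]
    exact smul_ne_zero (by norm_num)
      (mul_ne_zero (ih fun j hj => h j (by omega)) (h n (by omega)))

end Average

/-! ### The steps `K j / (N 0 * ⋯ * N j)` -/

/-- The nonzero atom `(p ^ (-j ^ 2) - p ^ (-(j + 1) ^ 2)) / 2` of the `j`-th factor. -/
noncomputable def moranStep (p j : ℕ) : ℝ :=
  (((p : ℝ) ^ (j ^ 2))⁻¹ - ((p : ℝ) ^ ((j + 1) ^ 2))⁻¹) / 2

theorem prod_oddPowers (p n : ℕ) : ∏ i ∈ Finset.range n, oddPowers p i = p ^ (n ^ 2) := by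
  induction n with
  | zero => simp
  | succ n ih => rw [Finset.prod_range_succ, ih, oddPowers, ← pow_add]; congr 1; ring

theorem pow_succ_sq {M : Type*} [Monoid M] (p : M) (n : ℕ) :
    p ^ ((n + 1) ^ 2) = p ^ (n ^ 2) * p ^ (2 * n + 1) := by
  rw [← pow_add]; congr 1; ring

section Steps

variable {p : ℕ}

theorem two_mul_digit (hp4 : p % 4 = 3) (j : ℕ) :
    2 * (((oddPowers p j - 1) / 2 : ℕ) : ℝ) = (p : ℝ) ^ (2 * j + 1) - 1 := by
  have h : ((oddPowers p j : ℕ) : ℝ) = _ := congrArg (Nat.cast (R := ℝ)) (oddPowers_eq p hp4 j)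
  rw [oddPowers] at h ⊢
  push_cast at h ⊢
  linarith

theorem moranStep_eq (hp4 : p % 4 = 3) (j : ℕ) :
    (((oddPowers p j - 1) / 2 : ℕ) : ℝ) / ((∏ i ∈ Finset.range (j + 1), oddPowers p i : ℕ) : ℝ)
      = moranStep p j := by
  have h := two_mul_digit hp4 j
  have hp0 : (p : ℝ) ≠ 0 := by
    have : p ≠ 0 := by omega
    exact_mod_cast this
  rw [prod_oddPowers, moranStep, pow_succ_sq]
  push_cast
  rw [pow_succ_sq]
  field_simp
  linarith

theorem moranStep_mul_pow (hp4 : p % 4 = 3) (j : ℕ) :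
    moranStep p j * (p : ℝ) ^ ((j + 1) ^ 2) = ((oddPowers p j - 1) / 2 : ℕ) := by
  have hp0 : (p : ℝ) ≠ 0 := by
    have : p ≠ 0 := by omega
    exact_mod_cast this
  rw [← moranStep_eq hp4, prod_oddPowers]
  push_cast
  field_simp

theorem three_le_cast_of_mod_four (hp4 : p % 4 = 3) : (3 : ℝ) ≤ p := by
  have : 3 ≤ p := by omega
  exact_mod_cast this

theorem moranStep_pos (hp4 : p % 4 = 3) (j : ℕ) : 0 < moranStep p j := by
  have h3 := three_le_cast_of_mod_four hp4
  have : ((p : ℝ) ^ ((j + 1) ^ 2))⁻¹ < ((p : ℝ) ^ (j ^ 2))⁻¹ := by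
    apply inv_strictAnti₀ (by positivity)
    exact pow_lt_pow_right₀ (by linarith) (Nat.pow_lt_pow_left (by omega) (by norm_num))
  rw [moranStep]
  linarith

theorem sum_moranStep (p n k : ℕ) :
    ∑ j ∈ Finset.range k, moranStep p (n + j) =
      (((p : ℝ) ^ (n ^ 2))⁻¹ - ((p : ℝ) ^ ((n + k) ^ 2))⁻¹) / 2 := by
  induction k with
  | zero => simp
  | succ k ih => rw [Finset.sum_range_succ, ih, moranStep, ← add_assoc]; ring

theorem sum_moranStep_le (p n k : ℕ) :
    ∑ j ∈ Finset.range k, moranStep p (n + j) ≤ ((p : ℝ) ^ (n ^ 2))⁻¹ / 2 := by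
  rw [sum_moranStep]
  have : 0 ≤ ((p : ℝ) ^ ((n + k) ^ 2))⁻¹ := by positivity
  linarith

/-- All nodes of level `n` lie in `p^(-n²) ℤ`, because `a_j p^((j+1)²)` is the integer digit `K_j`.
-/
theorem binaryAvg_moranStep_congr (hp4 : p % 4 = 3) {V : Type*} [AddCommGroup V] [Module ℝ V]
    (n : ℕ) {f g : ℝ → V}
    (h : ∀ x, (∃ m : ℤ, x * (p : ℝ) ^ (n ^ 2) = m) → f x = g x) :
    binaryAvg (moranStep p) n f = binaryAvg (moranStep p) n g := by
  induction n generalizing f g with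
  | zero => exact h 0 ⟨0, by simp⟩
  | succ n ih =>
    have key : ∀ x, (∃ m : ℤ, x * (p : ℝ) ^ (n ^ 2) = m) →
        ∃ m : ℤ, x * (p : ℝ) ^ ((n + 1) ^ 2) = m := fun x ⟨m, hm⟩ =>
      ⟨m * p ^ (2 * n + 1), by rw [pow_succ_sq, ← mul_assoc, hm]; push_cast; rfl⟩
    rw [binaryAvg, binaryAvg, ih fun x hx => h x (key x hx),
      ih fun x hx => h (x + moranStep p n) ?_]
    obtain ⟨m, hm⟩ := key x hx
    exact ⟨m + ((oddPowers p n - 1) / 2 : ℕ), by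
      rw [add_mul, hm, moranStep_mul_pow hp4]; push_cast; rfl⟩

/-- The exponentials of frequency at most `p ^ (n ^ 2) / 3` have real part at least `1 / 2` on the
support of the tail of the convolution. -/
theorem half_le_re_expFun {n : ℕ} {s t : ℝ} (hp : 0 < p) (hs : 3 * |s| ≤ (p : ℝ) ^ (n ^ 2))
    (ht0 : 0 ≤ t) (ht : t ≤ ((p : ℝ) ^ (n ^ 2))⁻¹ / 2) : 1 / 2 ≤ (expFun s t).re := by
  have hP : (0 : ℝ) < (p : ℝ) ^ (n ^ 2) := by positivity
  have hst : |s * t| ≤ 1 / 6 := by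
    rw [abs_mul, abs_of_nonneg ht0]
    calc |s| * t ≤ ((p : ℝ) ^ (n ^ 2) / 3) * (((p : ℝ) ^ (n ^ 2))⁻¹ / 2) := by
          gcongr; linarith
      _ = 1 / 6 := by field_simp; norm_num
  have hpi := Real.pi_pos
  have habs : |2 * Real.pi * s * t| ≤ Real.pi / 3 := by
    rw [show 2 * Real.pi * s * t = (2 * Real.pi) * (s * t) by ring, abs_mul,
      abs_of_pos (by positivity)]
    nlinarith
  rw [expFun_re, ← Real.cos_abs, ← Real.cos_pi_div_three]
  exact Real.cos_le_cos_of_nonneg_of_le_pi (abs_nonneg _) (by linarith) habs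

/-- A pointwise lower bound on the real part passes to the average. It serves both the frame
estimate and the location of the zeros. -/
theorem half_le_norm_tailAvg_expFun (hp4 : p % 4 = 3) {n : ℕ} {s : ℝ}
    (hs : 3 * |s| ≤ (p : ℝ) ^ (n ^ 2)) (k : ℕ) :
    1 / 2 ≤ ‖binaryAvg (fun j => moranStep p (n + j)) k (expFun s)‖ := by
  refine le_trans ?_ (Complex.re_le_norm _)
  rw [binaryAvg_re, ← binaryAvg_const (fun j => moranStep p (n + j)) k (1 / 2 : ℝ)]
  exact binaryAvg_mono (fun j => (moranStep_pos hp4 _).le) k fun t h0 h1 =>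
    half_le_re_expFun (by omega) hs h0 (h1.trans (sum_moranStep_le p n k))

end Steps

/-! ### The frequencies and the frame inequality for the finite convolutions -/

/-- The frequencies `∑ j < n, ε j * p ^ (j ^ 2)`, `ε j ∈ {0, 1}`. -/
def towerFreqs (p : ℕ) : ℕ → Finset ℕ
  | 0 => {0}
  | n + 1 => towerFreqs p n ∪ (towerFreqs p n).map (addRightEmbedding (p ^ (n ^ 2)))

/-- The factor 3 does two jobs: it keeps tail phases within `π/3`, and it makes the shift by
`p^(n²)` produce only new frequencies. -/
theorem three_mul_le_of_mem_towerFreqs {p : ℕ} (hp : 3 ≤ p) {n l : ℕ} (hl : l ∈ towerFreqs p n) :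
    3 * l ≤ p ^ (n ^ 2) := by
  induction n generalizing l with
  | zero => simp_all [towerFreqs]
  | succ n ih =>
    have hstep : p ^ (n ^ 2) * p ≤ p ^ ((n + 1) ^ 2) := by
      rw [← pow_succ]
      exact Nat.pow_le_pow_right (by omega) (by rw [add_sq]; omega)
    have hpos : 0 < p ^ (n ^ 2) := by positivity
    rw [towerFreqs, Finset.mem_union, Finset.mem_map] at hl
    rcases hl with hl | ⟨l, hl, rfl⟩
    · nlinarith [ih hl]
    · rw [addRightEmbedding_apply]
      -- The level grows by `p^(2n+1)`, which is at least `p²` only for `n ≥ 1`; at `n = 0` the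
      -- claim is just `3 ≤ p`.
      rcases Nat.eq_zero_or_pos n with rfl | hn
      · simp_all [towerFreqs]
      · have h2 : p ^ (n ^ 2) * p ^ 2 ≤ p ^ ((n + 1) ^ 2) := by
          rw [← pow_add]
          exact Nat.pow_le_pow_right (by omega) (by rw [add_sq]; omega)
        have h9 : p ^ (n ^ 2) * 9 ≤ p ^ (n ^ 2) * p ^ 2 := Nat.mul_le_mul_left _ (by nlinarith)
        linarith [ih hl]

theorem sum_towerFreqs_succ {p : ℕ} (hp : 3 ≤ p) (n : ℕ) {M : Type*} [AddCommMonoid M]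
    (g : ℕ → M) :
    ∑ l ∈ towerFreqs p (n + 1), g l = ∑ l ∈ towerFreqs p n, (g l + g (l + p ^ (n ^ 2))) := by
  have hpos : 0 < p ^ (n ^ 2) := by positivity
  rw [towerFreqs, Finset.sum_union, Finset.sum_map, Finset.sum_add_distrib]
  · rfl
  · rw [Finset.disjoint_left]
    rintro l hl hl'
    obtain ⟨k, -, rfl⟩ := Finset.mem_map.1 hl'
    have := three_mul_le_of_mem_towerFreqs hp hl
    rw [addRightEmbedding_apply] at this
    omega

theorem towerFreqs_mono (p : ℕ) : Monotone (towerFreqs p) :=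
  monotone_nat_of_le_succ fun _ => Finset.subset_union_left

/-- The Fourier transform of `w` with respect to the `n`-th finite convolution. -/
noncomputable def finiteFourier (p n : ℕ) (w : ℝ → ℂ) (s : ℝ) : ℂ :=
  binaryAvg (moranStep p) n fun x => w x * expFun (-s) x

theorem finiteFourier_succ (p n : ℕ) (w : ℝ → ℂ) (s : ℝ) :
    finiteFourier p (n + 1) w s = (2⁻¹ : ℝ) • (finiteFourier p n w s +
      finiteFourier p n (fun x => w (x + moranStep p n)) s * expFun (-s) (moranStep p n)) := by
  simp only [finiteFourier, binaryAvg, expFun_add_right, ← mul_assoc, binaryAvg_mul_const]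

/-- The nodes of level `n` become integers after multiplication by `p^(n²)`, so the extra
exponential is 1 on them. -/
theorem finiteFourier_add_pow {p : ℕ} (hp4 : p % 4 = 3) (n : ℕ) (w : ℝ → ℂ) (s : ℝ) :
    finiteFourier p n w (s + (p : ℝ) ^ (n ^ 2)) = finiteFourier p n w s := by
  refine binaryAvg_moranStep_congr hp4 n fun x hx => ?_
  rw [neg_add, expFun_add_left, expFun_neg_eq_one_of_int hx, mul_one]

/-- The phase `exp (-2πi K / N)` with `N = 2 * K + 1` is close to `-1`. -/
theorem norm_one_add_expFun_moranStep_le {p : ℕ} (hp4 : p % 4 = 3) (n : ℕ) :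
    ‖1 + expFun (-(p : ℝ) ^ (n ^ 2)) (moranStep p n)‖ ≤ 4 / 3 * (9⁻¹ : ℝ) ^ n := by
  have h3 := three_le_cast_of_mod_four hp4
  have hp0 : (p : ℝ) ≠ 0 := by linarith
  have hN : (3 : ℝ) * 9 ^ n ≤ (p : ℝ) ^ (2 * n + 1) := by
    calc (3 : ℝ) * 9 ^ n = 3 ^ (2 * n + 1) := by rw [pow_succ, pow_mul]; norm_num; ring
      _ ≤ _ := by gcongr
  -- Since `p^(n²) a_n = (1 - 1/N_n)/2`, the phase is `-exp(iπ/N_n)`, at distance at most `π/N_n ≤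
  -- 4/(3 · 9^n)` from `-1`.
  have hx : 2 * Real.pi * (-(p : ℝ) ^ (n ^ 2)) * moranStep p n =
      Real.pi * ((p : ℝ) ^ (2 * n + 1))⁻¹ - Real.pi := by
    rw [moranStep, pow_succ_sq]
    field_simp
    ring
  rw [expFun_eq_ofReal_mul_I, hx, Complex.ofReal_sub, sub_mul, Complex.exp_sub_pi_mul_I,
    ← sub_eq_add_neg, norm_sub_rev, mul_comm]
  refine (Real.norm_exp_I_mul_ofReal_sub_one_le).trans ?_
  rw [Real.norm_of_nonneg (by positivity)]
  have hinv : ((p : ℝ) ^ (2 * n + 1))⁻¹ ≤ 3⁻¹ * 9⁻¹ ^ n := by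
    rw [inv_pow, ← mul_inv]
    exact inv_anti₀ (by positivity) hN
  calc Real.pi * ((p : ℝ) ^ (2 * n + 1))⁻¹ ≤ 4 * (3⁻¹ * 9⁻¹ ^ n) := by
        gcongr
        exact Real.pi_le_four
    _ = _ := by ring

/-- A perturbed parallelogram law: the cross terms combine to `Re (v * conj (w * (1 + z))) / 2`,
which vanishes for `z = -1`. -/
theorem norm_sq_half_add_sum_bounds (v w z : ℂ) (hz : ‖z‖ = 1) {c : ℝ} (hc : ‖1 + z‖ ≤ 2 * c) :
    (1 - c) * (2⁻¹ * (‖v‖ ^ 2 + ‖w‖ ^ 2)) ≤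
        ‖(2⁻¹ : ℝ) • (v + w)‖ ^ 2 + ‖(2⁻¹ : ℝ) • (v + w * z)‖ ^ 2 ∧
      ‖(2⁻¹ : ℝ) • (v + w)‖ ^ 2 + ‖(2⁻¹ : ℝ) • (v + w * z)‖ ^ 2 ≤
        (1 + c) * (2⁻¹ * (‖v‖ ^ 2 + ‖w‖ ^ 2)) := by
  have key : ‖(2⁻¹ : ℝ) • (v + w)‖ ^ 2 + ‖(2⁻¹ : ℝ) • (v + w * z)‖ ^ 2 =
      2⁻¹ * (‖v‖ ^ 2 + ‖w‖ ^ 2) +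
        2⁻¹ * (v * (starRingEnd ℂ) (w * (1 + z))).re := by
    have hwz : ‖w * z‖ ^ 2 = ‖w‖ ^ 2 := by rw [norm_mul, hz, mul_one]
    rw [norm_smul, norm_smul, mul_pow, mul_pow, ← Complex.normSq_eq_norm_sq (v + w),
      ← Complex.normSq_eq_norm_sq (v + w * z), Complex.normSq_add, Complex.normSq_add,
      Complex.normSq_eq_norm_sq, Complex.normSq_eq_norm_sq, Complex.normSq_eq_norm_sq, hwz,
      mul_add w, mul_one, map_add, mul_add v, Complex.add_re, Real.norm_of_nonneg (by norm_num)]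
    ring
  have hre : |(v * (starRingEnd ℂ) (w * (1 + z))).re| ≤ c * (‖v‖ ^ 2 + ‖w‖ ^ 2) := by
    refine (Complex.abs_re_le_norm _).trans ?_
    rw [norm_mul, RCLike.norm_conj, norm_mul]
    have hvw : 0 ≤ ‖v‖ * ‖w‖ := by positivity
    have hc0 : 0 ≤ c := by linarith [norm_nonneg (1 + z)]
    calc ‖v‖ * (‖w‖ * ‖1 + z‖) = ‖v‖ * ‖w‖ * ‖1 + z‖ := by ring
      _ ≤ ‖v‖ * ‖w‖ * (2 * c) := by gcongr
      _ ≤ _ := by nlinarith [mul_nonneg hc0 (sq_nonneg (‖v‖ - ‖w‖))]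
  rw [key]
  constructor <;> linarith [abs_le.1 hre]

/-- Doubling the frequencies and adding one digit costs a factor `1 ± c` with `c = (2/3) 9^(-n)`.
The stated constants are explicit bounds for the resulting products, chosen so that the induction
closes. -/
theorem finiteFourier_frame_bounds {p : ℕ} (hp4 : p % 4 = 3) (n : ℕ) (w : ℝ → ℂ) :
    (1 / 4 + 3 / 4 * (9⁻¹ : ℝ) ^ n) * binaryAvg (moranStep p) n (fun x => ‖w x‖ ^ 2) ≤
        ∑ l ∈ towerFreqs p n, ‖finiteFourier p n w l‖ ^ 2 ∧
      ∑ l ∈ towerFreqs p n, ‖finiteFourier p n w l‖ ^ 2 ≤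
        (4 - 3 * (9⁻¹ : ℝ) ^ n) * binaryAvg (moranStep p) n (fun x => ‖w x‖ ^ 2) := by
  induction n generalizing w with
  | zero => simp [towerFreqs, finiteFourier, binaryAvg, expFun_zero_right]; norm_num
  | succ n ih =>
    set w' : ℝ → ℂ := fun x => w (x + moranStep p n)
    set u : ℝ := 9⁻¹ ^ n with hu
    set c : ℝ := 2 / 3 * u
    set z : ℂ := expFun (-(p : ℝ) ^ (n ^ 2)) (moranStep p n)
    have hz : ‖1 + z‖ ≤ 2 * c :=
      (norm_one_add_expFun_moranStep_le hp4 n).trans_eq (by simp only [c]; ring)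
    have hterm (l : ℕ) := norm_sq_half_add_sum_bounds (finiteFourier p n w l)
      (finiteFourier p n w' l * expFun (-l) (moranStep p n)) z (norm_expFun _ _) hz
    have hsum : ∑ l ∈ towerFreqs p (n + 1), ‖finiteFourier p (n + 1) w l‖ ^ 2 =
        ∑ l ∈ towerFreqs p n, (‖(2⁻¹ : ℝ) • (finiteFourier p n w l +
            finiteFourier p n w' l * expFun (-l) (moranStep p n))‖ ^ 2 +
          ‖(2⁻¹ : ℝ) • (finiteFourier p n w l +
            finiteFourier p n w' l * expFun (-l) (moranStep p n) * z)‖ ^ 2) := by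
      rw [sum_towerFreqs_succ (by omega)]
      refine Finset.sum_congr rfl fun l _ => ?_
      push_cast
      rw [finiteFourier_succ, finiteFourier_succ, finiteFourier_add_pow hp4,
        finiteFourier_add_pow hp4, neg_add, expFun_add_left, mul_assoc]
    have hnorm : ∑ l ∈ towerFreqs p n, 2⁻¹ * (‖finiteFourier p n w l‖ ^ 2 +
          ‖finiteFourier p n w' l * expFun (-l) (moranStep p n)‖ ^ 2) =
        2⁻¹ * (∑ l ∈ towerFreqs p n, ‖finiteFourier p n w l‖ ^ 2 +
          ∑ l ∈ towerFreqs p n, ‖finiteFourier p n w' l‖ ^ 2) := by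
      simp only [norm_mul, norm_expFun, mul_one, Finset.mul_sum, Finset.sum_add_distrib, mul_add]
    obtain ⟨l1, u1⟩ := ih w
    obtain ⟨l2, u2⟩ := ih w'
    have hlow := Finset.sum_le_sum fun l (_ : l ∈ towerFreqs p n) => (hterm l).1
    have hup := Finset.sum_le_sum fun l (_ : l ∈ towerFreqs p n) => (hterm l).2
    rw [← Finset.mul_sum, hnorm, ← hsum] at hlow hup
    have hS : binaryAvg (moranStep p) (n + 1) (fun x => ‖w x‖ ^ 2) =
        2⁻¹ * (binaryAvg (moranStep p) n (fun x => ‖w x‖ ^ 2) +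
          binaryAvg (moranStep p) n (fun x => ‖w' x‖ ^ 2)) := rfl
    have hnonneg (v : ℝ → ℂ) : 0 ≤ binaryAvg (moranStep p) n (fun x => ‖v x‖ ^ 2) :=
      (sq_nonneg _).trans (norm_sq_binaryAvg_le _ n v)
    have hu0 : 0 < u := by positivity
    have hu1 : u ≤ 1 := pow_le_one₀ (by norm_num) (by norm_num)
    set S := binaryAvg (moranStep p) n (fun x => ‖w x‖ ^ 2)
    set S' := binaryAvg (moranStep p) n (fun x => ‖w' x‖ ^ 2)
    have hSS : 0 ≤ S + S' := add_nonneg (hnonneg w) (hnonneg w')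
    rw [hS, pow_succ, ← hu]
    -- With `u = 9^(-n)`, the margins in the two constants are `(u - u²)/2` below and `2u²` above.
    refine ⟨le_trans ?_ hlow, hup.trans ?_⟩
    · calc (1 / 4 + 3 / 4 * (u * 9⁻¹)) * (2⁻¹ * (S + S'))
          ≤ ((1 - c) * (1 / 4 + 3 / 4 * u)) * (2⁻¹ * (S + S')) := by
            gcongr
            simp only [c]
            nlinarith
        _ = (1 - c) * (2⁻¹ * ((1 / 4 + 3 / 4 * u) * S + (1 / 4 + 3 / 4 * u) * S')) := by ring
        _ ≤ _ := by
            have : 0 ≤ 1 - c := by simp only [c]; linarith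
            gcongr
    · calc _ ≤ (1 + c) * (2⁻¹ * ((4 - 3 * u) * S + (4 - 3 * u) * S')) := by
            have : 0 ≤ 1 + c := by simp only [c]; linarith
            gcongr
        _ = ((1 + c) * (4 - 3 * u)) * (2⁻¹ * (S + S')) := by ring
        _ ≤ _ := by
            gcongr
            simp only [c]
            nlinarith

theorem finiteFourier_frame_lower {p : ℕ} (hp4 : p % 4 = 3) (n : ℕ) (w : ℝ → ℂ) :
    1 / 4 * binaryAvg (moranStep p) n (fun x => ‖w x‖ ^ 2) ≤
      ∑ l ∈ towerFreqs p n, ‖finiteFourier p n w l‖ ^ 2 := by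
  refine le_trans ?_ (finiteFourier_frame_bounds hp4 n w).1
  have h0 : 0 ≤ binaryAvg (moranStep p) n (fun x => ‖w x‖ ^ 2) :=
    (sq_nonneg _).trans (norm_sq_binaryAvg_le _ n w)
  gcongr
  simp only [le_add_iff_nonneg_right]
  positivity

theorem finiteFourier_frame_upper {p : ℕ} (hp4 : p % 4 = 3) (n : ℕ) (w : ℝ → ℂ) :
    ∑ l ∈ towerFreqs p n, ‖finiteFourier p n w l‖ ^ 2 ≤
      4 * binaryAvg (moranStep p) n (fun x => ‖w x‖ ^ 2) := by
  refine (finiteFourier_frame_bounds hp4 n w).2.trans ?_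
  have h0 : 0 ≤ binaryAvg (moranStep p) n (fun x => ‖w x‖ ^ 2) :=
    (sq_nonneg _).trans (norm_sq_binaryAvg_le _ n w)
  gcongr
  simp only [sub_le_self_iff]
  positivity

/-- Passing to a later finite convolution costs a factor `8` in the lower frame bound and an error
controlled by the oscillation `η` of `w`. -/
theorem finiteFourier_frame_lower_tail {p : ℕ} (hp4 : p % 4 = 3) (n k : ℕ) (w : ℝ → ℂ) {η : ℝ}
    (hη : ∀ x t, 0 ≤ x → x ≤ 1 → 0 ≤ t → t ≤ ((p : ℝ) ^ (n ^ 2))⁻¹ / 2 → ‖w (x + t) - w x‖ ≤ η) :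
    1 / 32 * binaryAvg (moranStep p) n (fun x => ‖w x‖ ^ 2) - 4 * η ^ 2 ≤
      ∑ l ∈ towerFreqs p n, ‖finiteFourier p (n + k) w l‖ ^ 2 := by
  set b : ℕ → ℝ := fun j => moranStep p (n + j)
  -- Write `w (x + t) = w x + (w (x + t) - w x)`: the main part factors through the tail transform,
  -- the rest is an oscillation error.
  have hsplit (l : ℕ) : finiteFourier p (n + k) w l =
      finiteFourier p n w l * binaryAvg b k (expFun (-l)) +
        binaryAvg b k fun t =>
          finiteFourier p n (fun x => w (x + t) - w x) l * expFun (-l) t := by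
    rw [mul_comm (finiteFourier p n w l), ← binaryAvg_mul_const, ← binaryAvg_add, finiteFourier,
      binaryAvg_split]
    congr 1
    ext t
    rw [mul_comm (expFun _ _), ← add_mul, finiteFourier, finiteFourier, ← binaryAvg_add,
      ← binaryAvg_mul_const]
    congr 1
    ext x
    rw [expFun_add_right]
    ring
  -- From `‖H‖/2 ≤ ‖H τ + R‖ + ‖R‖`, squaring costs a further factor 2, whence `1/8`.
  have hterm (l : ℕ) (hl : l ∈ towerFreqs p n) : 1 / 8 * ‖finiteFourier p n w l‖ ^ 2 ≤
      ‖finiteFourier p (n + k) w l‖ ^ 2 +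
        binaryAvg b k fun t => ‖finiteFourier p n (fun x => w (x + t) - w x) l‖ ^ 2 := by
    set H := finiteFourier p n w l
    set τ := binaryAvg b k (expFun (-l))
    set R := binaryAvg b k fun t =>
      finiteFourier p n (fun x => w (x + t) - w x) l * expFun (-l) t
    have hτ : 1 / 2 ≤ ‖τ‖ := by
      refine half_le_norm_tailAvg_expFun hp4 ?_ k
      rw [abs_neg, Nat.abs_cast]
      exact_mod_cast three_mul_le_of_mem_towerFreqs (by omega) hl
    have hR : ‖R‖ ^ 2 ≤
        binaryAvg b k fun t => ‖finiteFourier p n (fun x => w (x + t) - w x) l‖ ^ 2 := by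
      refine (norm_sq_binaryAvg_le b k _).trans_eq ?_
      simp only [norm_mul, norm_expFun, mul_one]
    have htri : ‖H‖ * ‖τ‖ ≤ ‖H * τ + R‖ + ‖R‖ := by
      rw [← norm_mul]
      simpa using norm_sub_le (H * τ + R) R
    have h1 : ‖H‖ * (1 / 2) ≤ ‖H * τ + R‖ + ‖R‖ :=
      (mul_le_mul_of_nonneg_left hτ (norm_nonneg _)).trans htri
    rw [hsplit]
    nlinarith [sq_nonneg (‖H * τ + R‖ - ‖R‖), norm_nonneg H, norm_nonneg R,
      norm_nonneg (H * τ + R)]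
  -- For each fixed tail value `t`, the upper frame bound is applied to `x ↦ w (x + t) - w x`; the
  -- error therefore does not grow with the number of frequencies.
  have herr : ∑ l ∈ towerFreqs p n, (binaryAvg b k fun t =>
      ‖finiteFourier p n (fun x => w (x + t) - w x) l‖ ^ 2) ≤ 4 * η ^ 2 := by
    rw [← binaryAvg_sum, ← binaryAvg_const b k (4 * η ^ 2)]
    refine binaryAvg_mono (fun j => (moranStep_pos hp4 _).le) k fun t ht0 ht => ?_
    refine (finiteFourier_frame_upper hp4 n _).trans ?_
    rw [← binaryAvg_const (moranStep p) n (η ^ 2)]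
    refine mul_le_mul_of_nonneg_left ?_ (by norm_num)
    refine binaryAvg_mono (fun j => (moranStep_pos hp4 _).le) n fun x hx0 hx => ?_
    have hx1 : x ≤ 1 := by
      have := sum_moranStep_le p 0 n
      simp only [zero_add] at this
      norm_num at this
      linarith
    have := hη x t hx0 hx1 ht0 (ht.trans (sum_moranStep_le p n k))
    gcongr
  have hsum := Finset.sum_le_sum hterm
  rw [← Finset.mul_sum, Finset.sum_add_distrib] at hsum
  linarith [finiteFourier_frame_lower hp4 n w]

/-! ### The infinite convolution as the law of a random sum -/

/-- The uniform measure on `Bool`. -/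
noncomputable def fairCoin : Measure Bool :=
  (2⁻¹ : ℝ≥0∞) • (Measure.dirac false + Measure.dirac true)

instance : IsProbabilityMeasure fairCoin :=
  ⟨by simp [fairCoin, ENNReal.inv_two_add_inv_two]⟩

theorem fairCoin_singleton (b : Bool) : fairCoin {b} = 2⁻¹ := by
  cases b <;> simp [fairCoin]

/-- Independent fair coin tosses. -/
noncomputable def coinTosses : Measure (ℕ → Bool) := Measure.infinitePi fun _ => fairCoin

instance : IsProbabilityMeasure coinTosses := by unfold coinTosses; infer_instance

theorem coinTosses_singleton (ω : ℕ → Bool) : coinTosses {ω} = 0 := by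
  have hle (n : ℕ) : coinTosses {ω} ≤ (2⁻¹ : ℝ≥0∞) ^ n := by
    calc coinTosses {ω} ≤ coinTosses (Set.pi (Finset.range n) fun i => {ω i}) :=
          measure_mono (by rintro _ rfl i _; rfl)
      _ = (2⁻¹ : ℝ≥0∞) ^ n := by
          rw [coinTosses, Measure.infinitePi_pi _ (fun _ _ => measurableSet_singleton _)]
          simp [fairCoin_singleton]
  have hlim := ENNReal.tendsto_pow_atTop_nhds_zero_of_lt_one (r := 2⁻¹) (by norm_num)
  exact nonpos_iff_eq_zero.1 (ge_of_tendsto' hlim hle)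

/-- The `j`-th summand of the random sum. -/
noncomputable def coinStep (p j : ℕ) (b : Bool) : ℝ := if b then moranStep p j else 0

/-- The sum of the steps from the `n`-th one on, each taken according to the coin tosses `ω`. -/
noncomputable def moranTail (p n : ℕ) (ω : ℕ → Bool) : ℝ :=
  ∑' j, coinStep p (n + j) (ω (n + j))

/-- The law of the random sum. -/
noncomputable def moranLaw (p : ℕ) : Measure ℝ := coinTosses.map (moranTail p 0)

section RandomSum

variable {p : ℕ}

theorem coinStep_nonneg (hp4 : p % 4 = 3) (j : ℕ) (b : Bool) : 0 ≤ coinStep p j b := by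
  rw [coinStep]
  split_ifs
  exacts [(moranStep_pos hp4 j).le, le_rfl]

theorem coinStep_le (hp4 : p % 4 = 3) (j : ℕ) (b : Bool) : coinStep p j b ≤ moranStep p j := by
  rw [coinStep]
  split_ifs
  exacts [le_rfl, (moranStep_pos hp4 j).le]

theorem summable_moranStep (hp4 : p % 4 = 3) (n : ℕ) : Summable fun j => moranStep p (n + j) :=
  summable_of_sum_range_le (fun _ => (moranStep_pos hp4 _).le) (sum_moranStep_le p n)

theorem summable_coinStep (hp4 : p % 4 = 3) (n : ℕ) (ω : ℕ → Bool) :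
    Summable fun j => coinStep p (n + j) (ω (n + j)) :=
  (summable_moranStep hp4 n).of_nonneg_of_le (fun _ => coinStep_nonneg hp4 _ _)
    fun _ => coinStep_le hp4 _ _

theorem moranTail_nonneg (hp4 : p % 4 = 3) (n : ℕ) (ω : ℕ → Bool) : 0 ≤ moranTail p n ω :=
  tsum_nonneg fun _ => coinStep_nonneg hp4 _ _

theorem moranTail_le (hp4 : p % 4 = 3) (n : ℕ) (ω : ℕ → Bool) :
    moranTail p n ω ≤ ((p : ℝ) ^ (n ^ 2))⁻¹ / 2 :=
  ((summable_coinStep hp4 n ω).tsum_le_tsum (fun _ => coinStep_le hp4 _ _)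
    (summable_moranStep hp4 n)).trans
    (Real.tsum_le_of_sum_range_le (fun _ => (moranStep_pos hp4 _).le) (sum_moranStep_le p n))

theorem moranTail_eq_add (hp4 : p % 4 = 3) (n : ℕ) (ω : ℕ → Bool) :
    moranTail p n ω = coinStep p n (ω n) + moranTail p (n + 1) ω := by
  rw [moranTail, (summable_coinStep hp4 n ω).tsum_eq_zero_add, moranTail]
  simp only [add_zero, add_assoc, add_comm 1]

theorem continuous_moranTail (hp4 : p % 4 = 3) (n : ℕ) : Continuous (moranTail p n) := by
  refine continuous_tsum (fun j => ?_) (summable_moranStep hp4 n) fun j ω => ?_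
  · exact (continuous_of_discreteTopology (f := coinStep p (n + j))).comp (continuous_apply _)
  · rw [Real.norm_of_nonneg (coinStep_nonneg hp4 _ _)]
    exact coinStep_le hp4 _ _

theorem measurable_moranTail (hp4 : p % 4 = 3) (n : ℕ) : Measurable (moranTail p n) :=
  (continuous_moranTail hp4 n).measurable

theorem isProbabilityMeasure_moranLaw (hp4 : p % 4 = 3) : IsProbabilityMeasure (moranLaw p) :=
  Measure.isProbabilityMeasure_map (measurable_moranTail hp4 0).aemeasurable

/-- Each step exceeds the largest possible sum of all later steps, so the digits can be read off one
after another. -/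
theorem injective_moranTail (hp4 : p % 4 = 3) : Function.Injective (moranTail p 0) := by
  intro ω ω' h
  have h3 := three_le_cast_of_mod_four hp4
  have hstep (n : ℕ) (hn : moranTail p n ω = moranTail p n ω') :
      ω n = ω' n ∧ moranTail p (n + 1) ω = moranTail p (n + 1) ω' := by
    have hgap : ((p : ℝ) ^ ((n + 1) ^ 2))⁻¹ / 2 < moranStep p n := by
      have hP : (0 : ℝ) < (p : ℝ) ^ (n ^ 2) := by positivity
      have : ((p : ℝ) ^ ((n + 1) ^ 2))⁻¹ ≤ ((p : ℝ) ^ (n ^ 2))⁻¹ / 3 := by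
        rw [pow_succ_sq, mul_inv, div_eq_mul_inv]
        gcongr
        exact h3.trans (le_self_pow₀ (by linarith) (by omega))
      rw [moranStep]
      linarith [inv_pos.2 hP]
    have h1 := moranTail_nonneg hp4 (n + 1) ω
    have h2 := moranTail_nonneg hp4 (n + 1) ω'
    have h1' := moranTail_le hp4 (n + 1) ω
    have h2' := moranTail_le hp4 (n + 1) ω'
    rw [moranTail_eq_add hp4 n ω, moranTail_eq_add hp4 n ω'] at hn
    rcases hb : ω n <;> rcases hb' : ω' n <;> simp only [coinStep, hb, hb'] at hn <;>
      simp only [if_true, Bool.false_eq_true, if_false] at hn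
    · exact ⟨rfl, by linarith⟩
    · linarith
    · linarith
    · exact ⟨rfl, by linarith⟩
  have hall (n : ℕ) : moranTail p n ω = moranTail p n ω' := by
    induction n with
    | zero => exact h
    | succ n ih => exact (hstep n ih).2
  exact funext fun n => (hstep n (hall n)).1

theorem moranLaw_singleton (hp4 : p % 4 = 3) (x : ℝ) : moranLaw p {x} = 0 := by
  rw [moranLaw, Measure.map_apply (measurable_moranTail hp4 0) (measurableSet_singleton x)]
  have hsub : (moranTail p 0 ⁻¹' {x}).Subsingleton :=
    Set.subsingleton_singleton.preimage (injective_moranTail hp4)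
  rcases hsub.eq_empty_or_singleton with h | ⟨ω, h⟩ <;> rw [h]
  exacts [measure_empty, coinTosses_singleton ω]

/-! ### Compact support of Lebesgue measure zero -/

theorem isCompact_range_moranTail (hp4 : p % 4 = 3) (n : ℕ) :
    IsCompact (Set.range (moranTail p n)) :=
  isCompact_range (continuous_moranTail hp4 n)

theorem moranLaw_compl_range (hp4 : p % 4 = 3) :
    moranLaw p (Set.range (moranTail p 0))ᶜ = 0 := by
  rw [moranLaw, Measure.map_apply (measurable_moranTail hp4 0)
    (isCompact_range_moranTail hp4 0).measurableSet.compl]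
  convert measure_empty (μ := coinTosses)
  ext ω
  simp

theorem volume_range_moranTail_le (hp4 : p % 4 = 3) (n : ℕ) :
    volume (Set.range (moranTail p n)) ≤ 2 * volume (Set.range (moranTail p (n + 1))) := by
  have hsub : Set.range (moranTail p n) ⊆ Set.range (moranTail p (n + 1)) ∪
      (fun x => x + -moranStep p n) ⁻¹' Set.range (moranTail p (n + 1)) := by
    rintro _ ⟨ω, rfl⟩
    rw [moranTail_eq_add hp4, coinStep]
    split_ifs
    · exact Or.inr ⟨ω, by ring⟩
    · exact Or.inl ⟨ω, by ring⟩
  refine (measure_mono hsub).trans ((measure_union_le _ _).trans_eq ?_)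
  rw [measure_preimage_add_right, two_mul]

/-- After `n` digits, `2^n` translates of a set of diameter at most `p^(-n²)/2 ≤ 3^(-n)/2` remain.
-/
theorem volume_range_moranTail (hp4 : p % 4 = 3) : volume (Set.range (moranTail p 0)) = 0 := by
  have h3 := three_le_cast_of_mod_four hp4
  have hiter (n : ℕ) :
      volume (Set.range (moranTail p 0)) ≤ 2 ^ n * volume (Set.range (moranTail p n)) := by
    induction n with
    | zero => simp
    | succ n ih =>
      refine ih.trans ?_
      rw [pow_succ, mul_assoc]
      gcongr
      exact volume_range_moranTail_le hp4 n
  have hle (n : ℕ) : volume (Set.range (moranTail p 0)) ≤ ENNReal.ofReal ((2 / 3) ^ n) := by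
    refine (hiter n).trans ?_
    have hsub : Set.range (moranTail p n) ⊆ Set.Icc 0 (((p : ℝ) ^ (n ^ 2))⁻¹ / 2) := by
      rintro _ ⟨ω, rfl⟩
      exact ⟨moranTail_nonneg hp4 n ω, moranTail_le hp4 n ω⟩
    calc (2 : ℝ≥0∞) ^ n * volume (Set.range (moranTail p n))
        ≤ 2 ^ n * ENNReal.ofReal (((p : ℝ) ^ (n ^ 2))⁻¹ / 2) := by
          gcongr
          exact (measure_mono hsub).trans_eq (by rw [Real.volume_Icc, sub_zero])
      _ = ENNReal.ofReal (2 ^ n * (((p : ℝ) ^ (n ^ 2))⁻¹ / 2)) := by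
          rw [ENNReal.ofReal_mul (by positivity), ENNReal.ofReal_pow (by norm_num)]
          simp
      _ ≤ ENNReal.ofReal ((2 / 3) ^ n) := by
          apply ENNReal.ofReal_le_ofReal
          have hP : (3 : ℝ) ^ n ≤ (p : ℝ) ^ (n ^ 2) := by
            calc (3 : ℝ) ^ n ≤ p ^ n := by gcongr
              _ ≤ _ := pow_le_pow_right₀ (by linarith) (Nat.le_self_pow (by norm_num) n)
          have hinv : ((p : ℝ) ^ (n ^ 2))⁻¹ ≤ ((3 : ℝ) ^ n)⁻¹ := inv_anti₀ (by positivity) hP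
          have hpos : 0 ≤ ((p : ℝ) ^ (n ^ 2))⁻¹ := by positivity
          rw [div_pow, div_eq_mul_inv ((2 : ℝ) ^ n)]
          gcongr
          linarith
  have hlim : Tendsto (fun n : ℕ => ENNReal.ofReal ((2 / 3) ^ n)) atTop (𝓝 0) := by
    rw [← ENNReal.ofReal_zero]
    exact ENNReal.tendsto_ofReal
      (tendsto_pow_atTop_nhds_zero_of_lt_one (by norm_num) (by norm_num))
  exact nonpos_iff_eq_zero.1 (ge_of_tendsto' hlim hle)

theorem isFractalMeasure_moranLaw (hp4 : p % 4 = 3) : IsFractalMeasure (moranLaw p) where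
  isCompact_support := by
    refine (isCompact_range_moranTail hp4 0).of_isClosed_subset Measure.isClosed_support ?_
    exact Measure.support_subset_of_isClosed (isCompact_range_moranTail hp4 0).isClosed
      (mem_ae_iff.2 (moranLaw_compl_range hp4))
  noAtoms := moranLaw_singleton hp4
  singular := ⟨(Set.range (moranTail p 0))ᶜ,
    (isCompact_range_moranTail hp4 0).measurableSet.compl, moranLaw_compl_range hp4, by
      rw [compl_compl, volume_range_moranTail hp4]⟩

/-! ### Finite convolutions as laws of partial random sums -/

theorem moranFactor_eq (hp4 : p % 4 = 3) (j : ℕ) :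
    moranFactor (oddPowers p) (twoDigits p) j =
      (2⁻¹ : ℝ≥0∞) • (Measure.dirac 0 + Measure.dirac (moranStep p j)) := by
  have hne : (0 : ℕ) ≠ (oddPowers p j - 1) / 2 := by
    intro h
    have h1 := moranStep_mul_pow hp4 j
    rw [← h, Nat.cast_zero] at h1
    have h3 := three_le_cast_of_mod_four hp4
    exact (mul_pos (moranStep_pos hp4 j) (by positivity)).ne' h1
  rw [moranFactor, twoDigits, Finset.card_pair hne, Finset.sum_pair hne, moranStep_eq hp4]
  simp

instance (a : ℝ) : IsProbabilityMeasure
    ((2⁻¹ : ℝ≥0∞) • (Measure.dirac 0 + Measure.dirac a) : Measure ℝ) :=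
  ⟨by simp [ENNReal.inv_two_add_inv_two]⟩

theorem map_coinStep (p j : ℕ) : fairCoin.map (coinStep p j) =
    (2⁻¹ : ℝ≥0∞) • (Measure.dirac 0 + Measure.dirac (moranStep p j)) := by
  have hm : Measurable (coinStep p j) := measurable_of_finite _
  rw [fairCoin, Measure.map_smul, Measure.map_add _ _ hm, Measure.map_dirac' hm,
    Measure.map_dirac' hm]
  simp [coinStep]

theorem map_coinTosses_coinStep (p j : ℕ) : coinTosses.map (fun ω => coinStep p j (ω j)) =
    (2⁻¹ : ℝ≥0∞) • (Measure.dirac 0 + Measure.dirac (moranStep p j)) := by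
  have hm : Measurable (coinStep p j) := measurable_of_finite _
  rw [← map_coinStep, ← Measure.infinitePi_map_eval (fun _ : ℕ => fairCoin) j,
    Measure.map_map hm (measurable_pi_apply j)]
  rfl

theorem measurable_sum_coinStep (p n : ℕ) :
    Measurable (∑ j ∈ Finset.range n, fun ω : ℕ → Bool => coinStep p j (ω j)) := by
  have hsum : Measurable fun ω : ℕ → Bool => ∑ j ∈ Finset.range n, coinStep p j (ω j) :=
    Finset.measurable_sum _ fun j _ =>
      (measurable_of_finite (coinStep p j)).comp (measurable_pi_apply j)
  convert hsum
  exact Finset.sum_apply _ _ _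

theorem partialConv_eq_map (hp4 : p % 4 = 3) (n : ℕ) :
    partialConv (moranFactor (oddPowers p) (twoDigits p)) n =
      coinTosses.map (∑ j ∈ Finset.range n, fun ω => coinStep p j (ω j)) := by
  have hm (j : ℕ) : Measurable fun ω : ℕ → Bool => coinStep p j (ω j) :=
    (measurable_of_finite (coinStep p j)).comp (measurable_pi_apply j)
  have hind : ProbabilityTheory.iIndepFun (fun j (ω : ℕ → Bool) => coinStep p j (ω j))
      coinTosses :=
    ProbabilityTheory.iIndepFun_infinitePi fun j => measurable_of_finite (coinStep p j)
  induction n with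
  | zero =>
    rw [partialConv, Finset.range_zero, Finset.sum_empty]
    simp [Pi.zero_def]
  | succ n ih =>
    rw [partialConv, ih, Finset.sum_range_succ, moranFactor_eq hp4, ← map_coinTosses_coinStep,
      (hind.indepFun_finsetSum_of_notMem hm Finset.notMem_range_self).map_add_eq_map_conv_map
        (measurable_sum_coinStep p n) (hm n)]

theorem integral_partialConv (hp4 : p % 4 = 3) {V : Type*} [NormedAddCommGroup V]
    [NormedSpace ℝ V] [SecondCountableTopology V] [MeasurableSpace V] [BorelSpace V]
    [CompleteSpace V] (n : ℕ) (f : ℝ →ᵇ V) :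
    ∫ x, f x ∂partialConv (moranFactor (oddPowers p) (twoDigits p)) n =
      binaryAvg (moranStep p) n f := by
  have hprob (n : ℕ) :
      IsProbabilityMeasure (partialConv (moranFactor (oddPowers p) (twoDigits p)) n) := by
    rw [partialConv_eq_map hp4]
    exact Measure.isProbabilityMeasure_map (measurable_sum_coinStep p n).aemeasurable
  induction n generalizing f with
  | zero => simp [partialConv, binaryAvg]
  | succ n ih =>
    have := hprob n
    have hconv : partialConv (moranFactor (oddPowers p) (twoDigits p)) (n + 1) =
        (2⁻¹ : ℝ≥0∞) • (partialConv (moranFactor (oddPowers p) (twoDigits p)) n +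
          (partialConv (moranFactor (oddPowers p) (twoDigits p)) n).map (· + moranStep p n)) := by
      rw [partialConv, moranFactor_eq hp4, Measure.conv_comm, Measure.conv_smul_left,
        Measure.conv_comm, Measure.conv_add, Measure.conv_dirac, Measure.conv_dirac]
      simp
    have hmap : Measurable (· + moranStep p n) := measurable_add_const _
    have hprob' := Measure.isProbabilityMeasure_map (μ := partialConv
      (moranFactor (oddPowers p) (twoDigits p)) n) hmap.aemeasurable
    rw [hconv, integral_smul_measure, integral_add_measure (f.integrable _) (f.integrable _),
      integral_map hmap.aemeasurable f.continuous.aestronglyMeasurable, ih, binaryAvg]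
    congr 2
    · simp
    · exact ih (f.compContinuous ⟨(· + moranStep p n), continuous_add_const _⟩)

/-- On the coin-tossing space the partial sums converge pointwise, so dominated convergence applies.
-/
theorem tendsto_binaryAvg (hp4 : p % 4 = 3) {V : Type*} [NormedAddCommGroup V]
    [NormedSpace ℝ V] [SecondCountableTopology V] [MeasurableSpace V] [BorelSpace V]
    [CompleteSpace V] (f : ℝ →ᵇ V) :
    Tendsto (fun n => binaryAvg (moranStep p) n f) atTop (𝓝 (∫ x, f x ∂moranLaw p)) := by
  simp only [← integral_partialConv hp4, partialConv_eq_map hp4, moranLaw]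
  rw [integral_map (measurable_moranTail hp4 0).aemeasurable f.continuous.aestronglyMeasurable]
  simp only [integral_map (measurable_sum_coinStep p _).aemeasurable
    f.continuous.aestronglyMeasurable]
  refine tendsto_integral_of_dominated_convergence (fun _ => ‖f‖) (fun n => ?_)
    (integrable_const _) (fun n => ae_of_all _ fun ω => f.norm_coe_le_norm _)
    (ae_of_all _ fun ω => ?_)
  · exact (f.continuous.measurable.comp (measurable_sum_coinStep p n)).aestronglyMeasurable
  · refine (f.continuous.tendsto _).comp ?_
    have := (summable_coinStep hp4 0 ω).hasSum.tendsto_sum_nat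
    simpa only [Finset.sum_apply, zero_add, moranTail] using this

theorem isMoranMeasure_moranLaw (hp4 : p % 4 = 3) :
    IsMoranMeasure (oddPowers p) (twoDigits p) (moranLaw p) := fun f => by
  simpa only [integral_partialConv hp4] using tendsto_binaryAvg hp4 f

end RandomSum

/-! ### Orthogonal exponentials -/

section Orthogonality

variable {p : ℕ}

/-- The exponential function as a bounded continuous function. -/
noncomputable def expBCF (t : ℝ) : ℝ →ᵇ ℂ :=
  BoundedContinuousFunction.ofNormedAddCommGroup (expFun t) (continuous_expFun t) 1
    fun x => (norm_expFun t x).le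

theorem star_expFun (t x : ℝ) : (starRingEnd ℂ) (expFun t x) = expFun (-t) x := by
  rw [expFun, expFun, ← Complex.exp_conj]
  congr 1
  simp [Complex.conj_ofNat]

theorem inner_expLp (μ : Measure ℝ) [IsFiniteMeasure μ] (t : ℝ) (f : Lp ℂ 2 μ) :
    inner ℂ (expLp μ t) f = ∫ x, f x * expFun (-t) x ∂μ := by
  rw [L2.inner_def]
  refine integral_congr_ae ?_
  filter_upwards [(expFun_memLp μ t).coeFn_toLp] with x hx
  rw [expLp, hx, RCLike.inner_apply, star_expFun]

theorem inner_expLp_expLp (μ : Measure ℝ) [IsFiniteMeasure μ] (s t : ℝ) :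
    inner ℂ (expLp μ s) (expLp μ t) = ∫ x, expFun (t - s) x ∂μ := by
  rw [inner_expLp]
  refine integral_congr_ae ?_
  filter_upwards [(expFun_memLp μ t).coeFn_toLp] with x hx
  rw [expLp, hx, sub_eq_add_neg, expFun_add_left]

theorem exists_three_mul_abs_le_pow (hp4 : p % 4 = 3) (s : ℝ) :
    ∃ n : ℕ, 3 * |s| ≤ (p : ℝ) ^ (n ^ 2) := by
  have h3 := three_le_cast_of_mod_four hp4
  obtain ⟨n, hn⟩ := pow_unbounded_of_one_lt (3 * |s|) (show (1 : ℝ) < p by linarith)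
  exact ⟨n, hn.le.trans (pow_le_pow_right₀ (by linarith) (Nat.le_self_pow (by norm_num) n))⟩

/-- If no factor vanishes, a finite product is nonzero and all further partial products keep at
least half its modulus, so the limit is nonzero. -/
theorem exists_one_add_expFun_eq_zero (hp4 : p % 4 = 3) {s : ℝ}
    (hs : ∫ x, expFun s x ∂moranLaw p = 0) : ∃ j, 1 + expFun s (moranStep p j) = 0 := by
  by_contra! hne
  obtain ⟨n, hn⟩ := exists_three_mul_abs_le_pow hp4 s
  have hn0 : 0 < ‖binaryAvg (moranStep p) n (expFun s)‖ :=
    norm_pos_iff.2 (binaryAvg_expFun_ne_zero n s fun j _ => hne j)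
  have hle (k : ℕ) : ‖binaryAvg (moranStep p) n (expFun s)‖ * (1 / 2) ≤
      ‖binaryAvg (moranStep p) (k + n) (expFun s)‖ := by
    have : binaryAvg (moranStep p) (k + n) (expFun s) =
        binaryAvg (fun j => moranStep p (n + j)) k (expFun s) *
          binaryAvg (moranStep p) n (expFun s) := by
      rw [add_comm, binaryAvg_split, ← binaryAvg_mul_const]
      refine congrArg _ (funext fun t => ?_)
      simp only [expFun_add_right, binaryAvg_mul_const]
      exact mul_comm _ _
    rw [this, norm_mul, mul_comm]
    gcongr
    exact half_le_norm_tailAvg_expFun hp4 hn k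
  have hlim := (tendsto_add_atTop_iff_nat n).2 (tendsto_binaryAvg hp4 (expBCF s)).norm
  have hge := ge_of_tendsto' hlim hle
  have h0 : ∫ x, expBCF s x ∂moranLaw p = 0 := hs
  rw [h0, norm_zero] at hge
  linarith

/-- The zeros of the Fourier transform have the `2`-adic valuation `-1`. -/
theorem exists_odd_of_integral_expFun_eq_zero (hp4 : p % 4 = 3) {s : ℝ}
    (hs : ∫ x, expFun s x ∂moranLaw p = 0) :
    ∃ u v : ℤ, Odd u ∧ Odd v ∧ 2 * s * v = u := by
  obtain ⟨j, hj⟩ := exists_one_add_expFun_eq_zero hp4 hs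
  have hexp : Complex.exp ((2 * Real.pi * s * moranStep p j : ℝ) * Complex.I) =
      Complex.exp (Real.pi * Complex.I) := by
    rw [← expFun_eq_ofReal_mul_I, Complex.exp_pi_mul_I]
    linear_combination hj
  obtain ⟨m, hm⟩ := Complex.exp_eq_exp_iff_exists_int.1 hexp
  have hreal : 2 * Real.pi * s * moranStep p j = Real.pi + m * (2 * Real.pi) := by
    have h : ((2 * Real.pi * s * moranStep p j : ℝ) : ℂ) * Complex.I =
        ((Real.pi + m * (2 * Real.pi) : ℝ) : ℂ) * Complex.I := by
      rw [hm]
      push_cast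
      ring
    exact_mod_cast mul_right_cancel₀ Complex.I_ne_zero h
  have hstep : 2 * s * moranStep p j = 1 + 2 * m := by
    apply mul_left_cancel₀ Real.pi_ne_zero
    linarith
  have hodd : Odd p := Nat.odd_iff.2 (by omega)
  -- An odd power of `p` is again 3 mod 4; this makes the digit `K_j` odd.
  have hN : oddPowers p j % 4 = 3 := by
    have h9 : p ^ 2 % 4 = 1 := by rw [Nat.pow_mod, hp4]
    rw [oddPowers, pow_succ, pow_mul, Nat.mul_mod, Nat.pow_mod, h9, hp4]
    simp
  refine ⟨(1 + 2 * m) * p ^ ((j + 1) ^ 2), ((oddPowers p j - 1) / 2 : ℕ), ?_, ?_, ?_⟩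
  · exact Odd.mul ⟨m, by ring⟩ (Odd.pow (by exact_mod_cast hodd))
  · have : Odd ((oddPowers p j - 1) / 2) := Nat.odd_iff.2 (by omega)
    exact_mod_cast this
  · rw [Int.cast_natCast, ← moranStep_mul_pow hp4, ← mul_assoc, hstep]
    push_cast
    rfl

theorem encard_le_two_of_isMutuallyOrthogonal (hp4 : p % 4 = 3) [IsFiniteMeasure (moranLaw p)]
    {Λ : Set ℝ} (hΛ : IsMutuallyOrthogonal (moranLaw p) Λ) : Λ.encard ≤ 2 := by
  by_contra! hlt
  obtain ⟨T, hTΛ, hT⟩ := Set.exists_subset_encard_eq (Order.add_one_le_of_lt hlt)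
  obtain ⟨a, b, c, hab, hac, hbc, rfl⟩ := Set.encard_eq_three.1 hT
  have ha : a ∈ Λ := hTΛ (by simp)
  have hb : b ∈ Λ := hTΛ (by simp)
  have hc : c ∈ Λ := hTΛ (by simp)
  have hzero {s t : ℝ} (hs : s ∈ Λ) (ht : t ∈ Λ) (hst : s ≠ t) :=
    exists_odd_of_integral_expFun_eq_zero hp4
      ((inner_expLp_expLp (moranLaw p) s t).symm.trans (hΛ hs ht hst))
  obtain ⟨u₁, v₁, hu₁, hv₁, h₁⟩ := hzero ha hb hab
  obtain ⟨u₂, v₂, hu₂, hv₂, h₂⟩ := hzero hb hc hbc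
  obtain ⟨u₃, v₃, hu₃, hv₃, h₃⟩ := hzero ha hc hac
  -- This is `c - a = (b - a) + (c - b)` with denominators cleared: odd on the left, even on the
  -- right.
  have key : u₃ * v₁ * v₂ = v₃ * (u₁ * v₂ + u₂ * v₁) := by
    have : (u₃ * v₁ * v₂ : ℝ) = v₃ * (u₁ * v₂ + u₂ * v₁) := by
      rw [← h₁, ← h₂, ← h₃]
      ring
    exact_mod_cast this
  have hodd : Odd (u₃ * v₁ * v₂) := (hu₃.mul hv₁).mul hv₂
  rw [key] at hodd
  exact Int.not_even_iff_odd.2 hodd (((hu₁.mul hv₂).add_odd (hu₂.mul hv₁)).mul_left _)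

end Orthogonality

/-! ### Non-spectrality -/

/-- `L²` of a nonzero finite measure without atoms is infinite-dimensional. -/
theorem not_finite_Lp_of_noAtoms (μ : Measure ℝ) [IsFiniteMeasure μ] [NullSingletonClass μ]
    (hμ : μ ≠ 0) :
    ¬ Module.Finite ℂ (Lp ℂ 2 μ) := by
  intro hfin
  -- `arctan` is bounded, continuous and injective, so a nonzero polynomial in it lies in `L²` and
  -- vanishes only at finitely many points, a null set.
  let A : ℝ →ᵇ ℂ := BoundedContinuousFunction.ofNormedAddCommGroup
    (fun x => (Real.arctan x : ℂ)) (by fun_prop) (Real.pi / 2) fun x => by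
      rw [Complex.norm_real, Real.norm_eq_abs, abs_le]
      exact ⟨(Real.neg_pi_div_two_lt_arctan x).le, (Real.arctan_lt_pi_div_two x).le⟩
  let L : Polynomial ℂ →ₗ[ℂ] Lp ℂ 2 μ :=
    (BoundedContinuousFunction.toLp 2 μ ℂ).toLinearMap ∘ₗ (Polynomial.aeval A).toLinearMap
  have heval (q : Polynomial ℂ) (x : ℝ) :
      (Polynomial.aeval A q) x = q.eval (Real.arctan x : ℂ) := by
    induction q using Polynomial.induction_on' with
    | add r s hr hs => simp [hr, hs]
    | monomial n a => simp [A, Algebra.algebraMap_eq_smul_one, Polynomial.aeval_monomial]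
  have hL : Function.Injective L := by
    rw [injective_iff_map_eq_zero]
    intro q hq
    by_contra hq0
    have hae : ∀ᵐ x ∂μ, q.eval (Real.arctan x : ℂ) = 0 := by
      filter_upwards [BoundedContinuousFunction.coeFn_toLp μ (𝕜 := ℂ) (p := 2)
        (Polynomial.aeval A q), Lp.coeFn_zero ℂ 2 μ] with x hx hx0
      rw [← heval q, ← hx]
      exact (congrArg (fun g : Lp ℂ 2 μ => g x) hq).trans hx0
    have hfinset : {x : ℝ | q.eval (Real.arctan x : ℂ) = 0}.Finite := by
      refine Set.Finite.preimage (f := fun x : ℝ => (Real.arctan x : ℂ)) ?_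
        (Polynomial.finite_setOfPred_isRoot hq0)
      exact (Complex.ofReal_injective.comp Real.arctan_injective).injOn
    have hzero : μ Set.univ = 0 := by
      rw [← Set.union_compl_self {x : ℝ | q.eval (Real.arctan x : ℂ) = 0}]
      exact measure_union_null (hfinset.measure_zero μ) hae
    exact hμ (Measure.measure_univ_eq_zero.1 hzero)
  exact Polynomial.not_finite (Module.Finite.of_injective L hL)

theorem not_isSpectralMeasure_moranLaw {p : ℕ} (hp4 : p % 4 = 3) [IsFiniteMeasure (moranLaw p)]
    (hne : moranLaw p ≠ 0) : ¬ IsSpectralMeasure (moranLaw p) := by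
  rintro ⟨Λ, b, hb⟩
  have hΛ : IsMutuallyOrthogonal (moranLaw p) Λ := fun s hs t ht hst => by
    have : inner ℂ (b ⟨s, hs⟩) (b ⟨t, ht⟩) = 0 := b.orthonormal.2 (by simpa using hst)
    rwa [hb, hb] at this
  have hfin : Λ.Finite := Set.encard_lt_top_iff.1
    ((encard_le_two_of_isMutuallyOrthogonal hp4 hΛ).trans_lt (by decide))
  have := hfin.fintype
  have : NullSingletonClass (moranLaw p) := ⟨moranLaw_singleton hp4⟩
  exact not_finite_Lp_of_noAtoms _ hne (Module.Finite.of_basis b.toOrthonormalBasis.toBasis)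

/-! ### The Fourier frame -/

theorem tsum_iUnion_of_monotone {α : Type*} {Φ : ℕ → Finset α} (hΦ : Monotone Φ) {h : α → ℝ}
    (h0 : ∀ x, 0 ≤ h x) {C : ℝ} (hC : ∀ n, ∑ x ∈ Φ n, h x ≤ C) :
    Summable (fun x : (⋃ n, (Φ n : Set α)) => h x) ∧
      (∀ n, ∑ x ∈ Φ n, h x ≤ ∑' x : (⋃ n, (Φ n : Set α)), h x) ∧
      ∑' x : (⋃ n, (Φ n : Set α)), h x ≤ C := by
  classical
  have hbound (u : Finset (⋃ n, (Φ n : Set α))) : ∑ x ∈ u, h x ≤ C := by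
    have hex : ∃ n, ∀ x ∈ u, (x : α) ∈ Φ n := by
      have hmem (x : (⋃ n, (Φ n : Set α))) : ∃ n, (x : α) ∈ Φ n := by
        simpa using Set.mem_iUnion.1 x.2
      choose N hN using hmem
      exact ⟨u.sup N, fun x hx => hΦ (Finset.le_sup hx) (hN x)⟩
    obtain ⟨n, hn⟩ := hex
    calc ∑ x ∈ u, h x = ∑ x ∈ u.map (Function.Embedding.subtype _), h x := by
          rw [Finset.sum_map]; rfl
      _ ≤ ∑ x ∈ Φ n, h x := by
          refine Finset.sum_le_sum_of_subset_of_nonneg (fun x hx => ?_) fun x _ _ => h0 x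
          obtain ⟨y, hy, rfl⟩ := Finset.mem_map.1 hx
          exact hn y hy
      _ ≤ C := hC n
  have hs : Summable (fun x : (⋃ n, (Φ n : Set α)) => h x) :=
    summable_of_sum_le (fun x => h0 x) hbound
  refine ⟨hs, fun n => ?_, hs.tsum_le_of_sum_le hbound⟩
  rw [← Finset.sum_subtype_of_mem h (p := (· ∈ ⋃ n, (Φ n : Set α)))
    fun x hx => Set.mem_iUnion.2 ⟨n, hx⟩]
  exact hs.sum_le_tsum _ fun x _ => h0 x

section Frame

variable {p : ℕ} [IsProbabilityMeasure (moranLaw p)]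

theorem norm_sq_toLp (μ : Measure ℝ) [IsFiniteMeasure μ] (g : ℝ →ᵇ ℂ) :
    ‖BoundedContinuousFunction.toLp 2 μ ℂ g‖ ^ 2 = ∫ x, ‖g x‖ ^ 2 ∂μ := by
  rw [← inner_self_eq_norm_sq (𝕜 := ℂ), L2.inner_def, ← integral_re (L2.integrable_inner _ _)]
  refine integral_congr_ae ?_
  filter_upwards [BoundedContinuousFunction.coeFn_toLp μ (𝕜 := ℂ) (p := 2) g] with x hx
  rw [hx, inner_self_eq_norm_sq]

theorem tendsto_binaryAvg_norm_sq (hp4 : p % 4 = 3) (g : ℝ →ᵇ ℂ) :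
    Tendsto (fun n => binaryAvg (moranStep p) n fun x => ‖g x‖ ^ 2) atTop
      (𝓝 (‖BoundedContinuousFunction.toLp 2 (moranLaw p) ℂ g‖ ^ 2)) := by
  rw [norm_sq_toLp]
  exact tendsto_binaryAvg hp4 (BoundedContinuousFunction.ofNormedAddCommGroup
    (fun x => ‖g x‖ ^ 2) (by fun_prop) (‖g‖ ^ 2) fun x => by
      rw [norm_pow, norm_norm]
      gcongr
      exact g.norm_coe_le_norm x)

theorem tendsto_finiteFourier (hp4 : p % 4 = 3) (g : ℝ →ᵇ ℂ) (t : ℝ) :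
    Tendsto (fun n => finiteFourier p n g t) atTop
      (𝓝 (inner ℂ (expLp (moranLaw p) t)
        (BoundedContinuousFunction.toLp 2 (moranLaw p) ℂ g))) := by
  have hinner : inner ℂ (expLp (moranLaw p) t)
      (BoundedContinuousFunction.toLp 2 (moranLaw p) ℂ g) =
        ∫ x, (g * expBCF (-t)) x ∂moranLaw p := by
    rw [inner_expLp]
    refine integral_congr_ae ?_
    filter_upwards [BoundedContinuousFunction.coeFn_toLp (moranLaw p) (𝕜 := ℂ) (p := 2) g]
      with x hx
    rw [hx]
    rfl
  rw [hinner]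
  exact tendsto_binaryAvg hp4 (g * expBCF (-t))

/-- The frequency sets are nested, so the sum over level `n` is bounded by the full sum at level `m
≥ n`, and `m → ∞` needs no tail estimate. -/
theorem sum_towerFreqs_inner_le (hp4 : p % 4 = 3) (n : ℕ) (f : Lp ℂ 2 (moranLaw p)) :
    ∑ l ∈ towerFreqs p n, ‖inner ℂ (expLp (moranLaw p) l) f‖ ^ 2 ≤ 4 * ‖f‖ ^ 2 := by
  induction f using (BoundedContinuousFunction.toLp_denseRange (p := 2) ℂ (moranLaw p) ℂ
    ENNReal.ofNat_ne_top).induction_on with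
  | hp => exact isClosed_le (by fun_prop) (by fun_prop)
  | ih g =>
    refine le_of_tendsto_of_tendsto
      (tendsto_finsetSum _ fun l _ => ((tendsto_finiteFourier hp4 g l).norm.pow 2))
      ((tendsto_binaryAvg_norm_sq hp4 g).const_mul 4) ?_
    filter_upwards [eventually_ge_atTop n] with m hm
    refine le_trans ?_ (finiteFourier_frame_upper hp4 m g)
    exact Finset.sum_le_sum_of_subset_of_nonneg (towerFreqs_mono p hm) fun _ _ _ => by positivity

/-- Three limits in order: tail length `k → ∞` at a fixed level `n`, then `n → ∞`, then oscillation
`η → 0`. -/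
theorem norm_sq_toLp_le (hp4 : p % 4 = 3) (g : ℝ →ᵇ ℂ) {C : ℝ}
    (hC : ∀ n, ∑ l ∈ towerFreqs p n, ‖inner ℂ (expLp (moranLaw p) l)
      (BoundedContinuousFunction.toLp 2 (moranLaw p) ℂ g)‖ ^ 2 ≤ C) :
    1 / 32 * ‖BoundedContinuousFunction.toLp 2 (moranLaw p) ℂ g‖ ^ 2 ≤ C := by
  have h3 := three_le_cast_of_mod_four hp4
  have hη (η : ℝ) (hη : 0 < η) :
      1 / 32 * ‖BoundedContinuousFunction.toLp 2 (moranLaw p) ℂ g‖ ^ 2 - 4 * η ^ 2 ≤ C := by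
    -- The interval `[0, 2]` contains every `x + t` with `x ≤ 1` and `t ≤ 1/2`.
    obtain ⟨δ, hδ, hg⟩ := Metric.uniformContinuousOn_iff_le.1
      ((isCompact_Icc (a := (0 : ℝ)) (b := 2)).uniformContinuousOn_of_continuous
        g.continuous.continuousOn) η hη
    refine le_of_tendsto
      (((tendsto_binaryAvg_norm_sq hp4 g).const_mul (1 / 32)).sub_const (4 * η ^ 2)) ?_
    obtain ⟨N, hN⟩ := exists_three_mul_abs_le_pow hp4 δ⁻¹
    filter_upwards [eventually_ge_atTop N] with n hn
    have hsmall : ((p : ℝ) ^ (n ^ 2))⁻¹ ≤ δ := by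
      rw [abs_of_pos (inv_pos.2 hδ)] at hN
      have hmono : (p : ℝ) ^ (N ^ 2) ≤ (p : ℝ) ^ (n ^ 2) :=
        pow_le_pow_right₀ (by linarith) (Nat.pow_le_pow_left hn 2)
      have hpos := inv_pos.2 hδ
      exact inv_le_of_inv_le₀ hδ (by linarith)
    have hone : ((p : ℝ) ^ (n ^ 2))⁻¹ ≤ 1 := inv_le_one_of_one_le₀ (one_le_pow₀ (by linarith))
    have hinv0 : 0 ≤ ((p : ℝ) ^ (n ^ 2))⁻¹ := by positivity
    have hosc (x t : ℝ) (hx0 : 0 ≤ x) (hx1 : x ≤ 1) (ht0 : 0 ≤ t)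
        (ht : t ≤ ((p : ℝ) ^ (n ^ 2))⁻¹ / 2) : ‖g (x + t) - g x‖ ≤ η := by
      rw [← dist_eq_norm]
      refine hg _ ⟨by linarith, by linarith⟩ _ ⟨hx0, by linarith⟩ ?_
      rw [Real.dist_eq, add_sub_cancel_left, abs_of_nonneg ht0]
      linarith
    refine le_trans ?_ (hC n)
    refine le_of_tendsto_of_tendsto' tendsto_const_nhds (tendsto_finsetSum _ fun l _ =>
      (((tendsto_add_atTop_iff_nat n).2 (tendsto_finiteFourier hp4 g l)).norm.pow 2)) fun k => ?_
    rw [add_comm k n]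
    exact finiteFourier_frame_lower_tail hp4 n k g hosc
  have hlim : Tendsto (fun η : ℝ =>
      1 / 32 * ‖BoundedContinuousFunction.toLp 2 (moranLaw p) ℂ g‖ ^ 2 - 4 * η ^ 2) (𝓝[>] 0)
      (𝓝 (1 / 32 * ‖BoundedContinuousFunction.toLp 2 (moranLaw p) ℂ g‖ ^ 2 - 4 * 0 ^ 2)) :=
    (Continuous.tendsto (by fun_prop) 0).mono_left nhdsWithin_le_nhds
  have := le_of_tendsto hlim (eventually_nhdsWithin_of_forall fun η h => hη η h)
  simpa using this

theorem norm_sq_le_of_sum_towerFreqs_le (hp4 : p % 4 = 3) (f : Lp ℂ 2 (moranLaw p)) {C : ℝ}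
    (hC : ∀ n, ∑ l ∈ towerFreqs p n, ‖inner ℂ (expLp (moranLaw p) l) f‖ ^ 2 ≤ C) :
    1 / 32 * ‖f‖ ^ 2 ≤ 2 * C := by
  -- The hypothesis concerns `f`, not its approximants. This inequality is closed in `h`, so it can
  -- be checked on bounded continuous functions and then read at `h = f`; the 8 is 2 times the upper
  -- frame bound 4.
  have happrox (h : Lp ℂ 2 (moranLaw p)) : 1 / 32 * ‖h‖ ^ 2 ≤ 2 * C + 8 * ‖h - f‖ ^ 2 := by
    induction h using (BoundedContinuousFunction.toLp_denseRange (p := 2) ℂ (moranLaw p) ℂ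
      ENNReal.ofNat_ne_top).induction_on with
    | hp => exact isClosed_le (by fun_prop) (by fun_prop)
    | ih g =>
      refine norm_sq_toLp_le hp4 g fun n => ?_
      set h := BoundedContinuousFunction.toLp 2 (moranLaw p) ℂ g
      have hterm (l : ℕ) : ‖inner ℂ (expLp (moranLaw p) l) h‖ ^ 2 ≤
          2 * ‖inner ℂ (expLp (moranLaw p) l) f‖ ^ 2 +
            2 * ‖inner ℂ (expLp (moranLaw p) l) (h - f)‖ ^ 2 := by
        have htri := norm_add_le (inner ℂ (expLp (moranLaw p) l) f)
          (inner ℂ (expLp (moranLaw p) l) (h - f))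
        rw [← inner_add_right, add_sub_cancel] at htri
        nlinarith [sq_nonneg (‖inner ℂ (expLp (moranLaw p) l) f‖ -
          ‖inner ℂ (expLp (moranLaw p) l) (h - f)‖), norm_nonneg (inner ℂ (expLp (moranLaw p) l) h)]
      have hsum := Finset.sum_le_sum fun l (_ : l ∈ towerFreqs p n) => hterm l
      rw [Finset.sum_add_distrib, ← Finset.mul_sum, ← Finset.mul_sum] at hsum
      linarith [hC n, sum_towerFreqs_inner_le hp4 n (h - f)]
  simpa using happrox f

theorem isFrameSpectralMeasure_moranLaw (hp4 : p % 4 = 3) :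
    IsFrameSpectralMeasure (moranLaw p) := by
  set Φ : ℕ → Finset ℝ := fun n => (towerFreqs p n).map Nat.castEmbedding
  refine ⟨⋃ n, (Φ n : Set ℝ), 1 / 64, 4, by norm_num, by norm_num, fun f => ?_⟩
  have hmono : Monotone Φ := fun m n hmn => Finset.map_subset_map.2 (towerFreqs_mono p hmn)
  have hcoeff (t : ℝ) : ‖∫ x, f x * Complex.exp (-2 * Real.pi * Complex.I * t * x) ∂moranLaw p‖ =
      ‖inner ℂ (expLp (moranLaw p) t) f‖ := by
    rw [inner_expLp]
    congr! with x
    rw [expFun]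
    congr 1
    push_cast
    ring
  have hsumΦ (n : ℕ) : ∑ t ∈ Φ n, ‖inner ℂ (expLp (moranLaw p) t) f‖ ^ 2 =
      ∑ l ∈ towerFreqs p n, ‖inner ℂ (expLp (moranLaw p) l) f‖ ^ 2 := Finset.sum_map _ _ _
  obtain ⟨hs, hle, hC⟩ := tsum_iUnion_of_monotone hmono
    (h := fun t => ‖inner ℂ (expLp (moranLaw p) t) f‖ ^ 2) (fun _ => by positivity)
    (C := 4 * ‖f‖ ^ 2) fun n => (hsumΦ n).trans_le (sum_towerFreqs_inner_le hp4 n f)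
  simp only [hcoeff]
  refine ⟨hs, ?_, hC⟩
  have := norm_sq_le_of_sum_towerFreqs_le hp4 f fun n => (hsumΦ n).symm.trans_le (hle n)
  linarith

end Frame

theorem theorem1p3 (p : ℕ) (hp : p.Prime) (hp4 : p % 4 = 3) :
    ∃ μ : ProbabilityMeasure ℝ,
      IsMoranMeasure (oddPowers p) (twoDigits p) (μ : Measure ℝ) ∧
      IsFractalMeasure (μ : Measure ℝ) ∧
      ¬ IsSpectralMeasure (μ : Measure ℝ) ∧
      (∀ Λ : Set ℝ, IsMutuallyOrthogonal (μ : Measure ℝ) Λ → Λ.encard ≤ 2) ∧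
      IsFrameSpectralMeasure (μ : Measure ℝ) := by
  have hprob := isProbabilityMeasure_moranLaw hp4
  exact ⟨⟨moranLaw p, hprob⟩, isMoranMeasure_moranLaw hp4, isFractalMeasure_moranLaw hp4,
    not_isSpectralMeasure_moranLaw hp4 (IsProbabilityMeasure.ne_zero _),
    fun Λ hΛ => encard_le_two_of_isMutuallyOrthogonal hp4 hΛ, isFrameSpectralMeasure_moranLaw hp4⟩
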